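/- Let $\Bbbk$ be an algebraically closed field of characteristic $0$, let $\mathfrak g$ be a finite-dimensional reductive Lie algebra over $\Bbbk$, and let $\sigma_1,\sigma_2$ be commuting automorphisms of $\mathfrak g$ with $\sigma_1^2=\sigma_2^2=\mathrm{id}$. For $i,j\in\{0,1\}$ put $$\mathfrak g_{ij}=\{x\in\mathfrak g\mid \sigma_1(x)=(-1)^i x,\ \sigma_2(x)=(-1)^j x\},$$ so that $\mathfrak g=\bigoplus_{i,j}\mathfrak g_{ij}$ is a $\mathbb Z_2\times\mathbb Z_2$-grading. For $x\in\mathfrak g$ let $\mathfrak z_{\mathfrak g}(x)=\{z\in\mathfrak g\mid [x,z]=0\}$ and $\mathfrak z_{\mathfrak g}(x)_{01}=\mathfrak z_{\mathfrak g}(x)\cap\mathfrak g_{01}$. Then the commutator map $$\varphi:\mathfrak g_{10}\times\mathfrak g_{11}\to\mathfrak g_{01},\qquad \varphi(x,y)=[x,y],$$ is dominant (that is, its image is dense in $\mathfrak g_{01}$ in the Zariski topology) if and only if there exist $x\in\mathfrak g_{10}$ and $y\in\mathfrak g_{11}$ such that $$\mathfrak z_{\mathfrak g}(x)_{01}\cap\mathfrak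 z_{\mathfrak g}(y)_{01}=\{0\}.$$ -/

import Mathlib

/-! ## Zariski topology on a vector space and dominant maps -/

/-- The algebra `k[V]` of polynomial functions on a vector space `V`, i.e. the `k`-algebra of
functions on `V` generated by the linear forms. -/
def vectorPolyFunctions (k V : Type*) [Field k] [AddCommGroup V] [Module k V] :
    Subalgebra k (V → k) :=
  Algebra.adjoin k (Set.range fun (l : Module.Dual k V) (v : V) => l v)

/-- The set of common zeros in `V` of a set `S` of functions on `V`. -/
def commonZeros {k V : Type*} [Field k] (S : Set (V → k)) : Set V :=
  {v | ∀ p ∈ S, p v = 0}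

/-- The Zariski topology on `V`: the closed sets are exactly the sets of common zeros of
families of polynomial functions. -/
@[reducible] def zariskiTopology (k V : Type*) [Field k] [AddCommGroup V] [Module k V] :
    TopologicalSpace V :=
  TopologicalSpace.ofClosed
    {Z | ∃ S : Set (V → k), S ⊆ (vectorPolyFunctions k V : Set (V → k)) ∧ Z = commonZeros S}
    ⟨{1}, by
      rintro p rfl
      exact one_mem (vectorPolyFunctions k V), by
      ext v
      simp [commonZeros]⟩
    (by
      intro A hA
      refine ⟨{p | p ∈ vectorPolyFunctions k V ∧ ∃ Z ∈ A, ∀ v ∈ Z, p v = 0},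
        fun p hp => hp.1, ?_⟩
      ext v
      constructor
      · rintro hv p ⟨-, Z, hZ, hp⟩
        exact hp v (hv Z hZ)
      · intro hv Z hZ
        obtain ⟨S, hS, rfl⟩ := hA hZ
        intro p hp
        exact hv p ⟨hS hp, commonZeros S, hZ, fun w hw => hw p hp⟩)
    (by
      rintro _ ⟨S, hS, rfl⟩ _ ⟨T, hT, rfl⟩
      refine ⟨{r | ∃ p ∈ S, ∃ q ∈ T, r = p * q}, ?_, ?_⟩
      · rintro _ ⟨p, hp, q, hq, rfl⟩
        exact mul_mem (hS hp) (hT hq)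
      · ext v
        constructor
        · rintro (hv | hv) _ ⟨p, hp, q, hq, rfl⟩
          · simp [hv p hp]
          · simp [hv q hq]
        · intro hv
          by_contra hcon
          simp only [Set.mem_union, not_or] at hcon
          obtain ⟨h1, h2⟩ := hcon
          simp only [commonZeros, Set.mem_ofPred_eq, not_forall] at h1 h2
          obtain ⟨p, hp, hpv⟩ := h1
          obtain ⟨q, hq, hqv⟩ := h2
          exact mul_ne_zero hpv hqv (hv (p * q) ⟨p, hp, q, hq, rfl⟩))

/-- A map to the affine space `V` is dominant if its image is Zariski dense in `V`. -/
def IsDominantMap (k : Type*) {X V : Type*} [Field k] [AddCommGroup V] [Module k V]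
    (f : X → V) : Prop :=
  letI : TopologicalSpace V := zariskiTopology k V
  Dense (Set.range f)

/-! ## The quaternionic decomposition of a Lie algebra -/

section Quaternionic

variable {k g : Type*} [Field k] [LieRing g] [LieAlgebra k g]

/-- The summand `g_{ij} = {x | σ₁ x = (-1)^i x and σ₂ x = (-1)^j x}`. -/
def gradedPart (σ₁ σ₂ : g ≃ₗ⁅k⁆ g) (i j : Fin 2) : Submodule k g where
  carrier := {x | σ₁ x = (-1 : k) ^ (i : ℕ) • x ∧ σ₂ x = (-1 : k) ^ (j : ℕ) • x}
  zero_mem' := by simp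
  add_mem' := by
    rintro x y ⟨hx₁, hx₂⟩ ⟨hy₁, hy₂⟩
    exact ⟨by rw [map_add, hx₁, hy₁, smul_add], by rw [map_add, hx₂, hy₂, smul_add]⟩
  smul_mem' := by
    rintro c x ⟨hx₁, hx₂⟩
    exact ⟨by rw [map_smul, hx₁, smul_comm], by rw [map_smul, hx₂, smul_comm]⟩

/-- The centraliser `z_g(x)` of an element `x`. -/
def elementCentralizer (k : Type*) {g : Type*} [Field k] [LieRing g] [LieAlgebra k g] (x : g) :
    Submodule k g where
  carrier := {z | ⁅x, z⁆ = 0}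
  zero_mem' := by simp
  add_mem' := by
    intro a b ha hb
    simp only [Set.mem_ofPred_eq] at ha hb ⊢
    rw [lie_add, ha, hb, add_zero]
  smul_mem' := by
    intro c a ha
    simp only [Set.mem_ofPred_eq] at ha ⊢
    rw [lie_smul, ha, smul_zero]

theorem lie_mem_gradedPart (σ₁ σ₂ : g ≃ₗ⁅k⁆ g) {x y : g}
    (hx : x ∈ gradedPart σ₁ σ₂ 1 0) (hy : y ∈ gradedPart σ₁ σ₂ 1 1) :
    ⁅x, y⁆ ∈ gradedPart σ₁ σ₂ 0 1 := by
  obtain ⟨hx₁, hx₂⟩ := hx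
  obtain ⟨hy₁, hy₂⟩ := hy
  constructor
  · rw [LieEquiv.map_lie, hx₁, hy₁]; simp
  · rw [LieEquiv.map_lie, hx₂, hy₂]; simp

/-- The commutator map `φ : g₁₀ × g₁₁ → g₀₁`, `(x, y) ↦ [x, y]`. -/
def commutatorMap (σ₁ σ₂ : g ≃ₗ⁅k⁆ g) :
    gradedPart σ₁ σ₂ 1 0 × gradedPart σ₁ σ₂ 1 1 → gradedPart σ₁ σ₂ 0 1 :=
  fun p => ⟨⁅(p.1 : g), (p.2 : g)⁆, lie_mem_gradedPart σ₁ σ₂ p.1.2 p.2.2⟩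

end Quaternionic

/-!
The differential of the commutator map at `(x, y)` is `(u, v) ↦ [u, y] + [x, v]`, and the proof has
two independent parts.

In characteristic zero, a polynomial map is dominant if and only if its differential is surjective
at some point. Dominance means algebraic independence of the coordinate functions
(`isDominantMap_iff_algebraicIndependent`). If the differential is surjective somewhere, the chain
rule shows that the partial derivatives of a polynomial relation are again relations, so there is
none (`MvPolynomial.algebraicIndependent_of_jacobian`). Conversely, algebraically independent
polynomials extend to a transcendence basis of the polynomial ring; a derivation killing such a
basis is zero, so the Jacobian determinant of the basis is a nonzero polynomial, and at a point
where it does not vanish the differential is surjective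
(`MvPolynomial.exists_jacobian_of_algebraicIndependent`).

The differential at `(x, y)` is surjective onto `g₀₁` if and only if no nonzero element of `g₀₁`
commutes with both `x` and `y` (`surjective_differential_iff`). The Killing form is invariant, and
distinct graded pieces are orthogonal, so `z ∈ g₀₁` is orthogonal to the image if and only if
`[x, z]` and `[y, z]` lie in the radical of the form. By Cartan's criterion this radical is the
centre. Central brackets vanish in a reductive Lie algebra: the Casimir operator of `g / z(g)`
acting on `g` kills the centre and fixes every bracket (`LieAlgebra.exists_casimir`).
-/

/-! ### The Jacobian criterion for algebraic independence -/

section Jacobian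

open MvPolynomial

/-- In characteristic zero, a derivation of a domain that vanishes on a subalgebra vanishes on
every element algebraic over it: differentiate a polynomial relation of minimal degree. -/
theorem Derivation.eq_zero_of_isAlgebraic {k A : Type*} [Field k] [CharZero k] [CommRing A]
    [IsDomain A] [Algebra k A] (D : Derivation k A A) (S : Subalgebra k A)
    (hS : ∀ s ∈ S, D s = 0) {x : A} (hx : IsAlgebraic S x) : D x = 0 := by
  let D' : Derivation S A A :=
    { toFun := D
      map_add' := map_add D
      map_smul' := fun s a => by
        simp [Subalgebra.smul_def, Derivation.leibniz, hS s s.2]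
      map_one_eq_zero' := D.map_one_eq_zero
      leibniz' := D.leibniz }
  have : CharZero S := charZero_of_injective_algebraMap (algebraMap k S).injective
  have key : ∀ n : ℕ, ∀ P : Polynomial S, P.natDegree = n → P ≠ 0 →
      Polynomial.aeval x P = 0 → D x = 0 := by
    intro n
    induction n using Nat.strong_induction_on with
    | _ n ih =>
      intro P hPn hP0 hPx
      have h1 : Polynomial.aeval x (Polynomial.derivative P) * D x = 0 := by
        have := D'.map_aeval P x
        rw [hPx, map_zero] at this
        exact this.symm
      rcases mul_eq_zero.mp h1 with h | h
      · have hdeg : P.natDegree ≠ 0 := by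
          intro h0
          rw [Polynomial.eq_C_of_natDegree_eq_zero h0, Polynomial.aeval_C] at hPx
          apply hP0
          rw [Polynomial.eq_C_of_natDegree_eq_zero h0,
            (FaithfulSMul.algebraMap_injective S A) (hPx.trans (map_zero _).symm), map_zero]
        exact ih _ (hPn ▸ Polynomial.natDegree_derivative_lt hdeg) _ rfl
          (fun h0 => hdeg (Polynomial.derivative_eq_zero.mp h0)) h
      · exact h
  obtain ⟨P, hP0, hPx⟩ := hx
  exact key _ P rfl hP0 hPx

theorem Derivation.map_mvPolynomial_aeval {k A ι : Type*} [CommRing k] [CommRing A] [Algebra k A]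
    [Fintype ι] (D : Derivation k A A) (F : ι → A) (p : MvPolynomial ι k) :
    D (aeval F p) = ∑ i, aeval F (pderiv i p) * D (F i) := by
  classical
  induction p using MvPolynomial.induction_on with
  | C a => simp
  | add p q hp hq => simp [hp, hq, add_mul, Finset.sum_add_distrib]
  | mul_X p j hp =>
    simp only [map_mul, aeval_X, Derivation.leibniz, smul_eq_mul, hp, pderiv_X, map_add, add_mul,
      Finset.sum_add_distrib, Finset.mul_sum]
    congr 1
    · rw [Finset.sum_eq_single j]
      · simp
      · intro b _ hb
        simp [hb.symm]
      · simp
    · exact Finset.sum_congr rfl fun i _ => by ring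

/-- The Jacobian matrix of a family of polynomials. -/
noncomputable def jacobian {k ι κ : Type*} [CommRing k] (F : ι → MvPolynomial κ k) :
    Matrix ι κ (MvPolynomial κ k) :=
  Matrix.of fun i j => pderiv j (F i)

/-- A polynomial all of whose partial derivatives vanish is constant, in characteristic zero. -/
theorem MvPolynomial.eq_C_of_pderiv_eq_zero {k ι : Type*} [Field k] [CharZero k]
    {p : MvPolynomial ι k} (hp : ∀ i, pderiv i p = 0) : p = C (coeff 0 p) := by
  classical
  ext m
  rw [coeff_C]
  split_ifs with hm
  · rw [hm]
  · obtain ⟨i, hi⟩ : ∃ i, m i ≠ 0 := by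
      by_contra! h
      exact hm (Finsupp.ext fun i => (h i).symm)
    have h1 := coeff_pderiv (i := i) p (m - Finsupp.single i 1)
    have hle : Finsupp.single i 1 ≤ m := by
      rw [Finsupp.single_le_iff]
      omega
    rw [hp i, coeff_zero, tsub_add_cancel_of_le hle] at h1
    exact (mul_eq_zero.mp h1.symm).resolve_right (Nat.cast_add_one_ne_zero _)

/-- If the Jacobian matrix has a right inverse at some point, the polynomials are algebraically
independent: applying the chain rule to a relation of minimal degree shows that its partial
derivatives are again relations, so that it is constant. -/
theorem MvPolynomial.algebraicIndependent_of_jacobian {k ι κ : Type*} [Field k] [CharZero k]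
    [Fintype ι] [DecidableEq ι] [Fintype κ] (F : ι → MvPolynomial κ k) (a : κ → k)
    (N : Matrix κ ι k) (hN : (jacobian F).map (eval a) * N = 1) : AlgebraicIndependent k F := by
  -- A determinant that evaluates to `1` at `a`; it stands in for a nonzero maximal minor.
  let NC : Matrix κ ι (MvPolynomial κ k) := N.map C
  have hdet : Matrix.det (jacobian F * NC : Matrix ι ι (MvPolynomial κ k)) ≠ 0 := by
    intro h
    have h1 : eval a (Matrix.det (jacobian F * NC : Matrix ι ι (MvPolynomial κ k))) = 1 := by
      rw [RingHom.map_det, RingHom.mapMatrix_apply, Matrix.map_mul, Matrix.map_map]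
      have : N.map (eval a ∘ C) = N := by ext; simp
      rw [this, hN, Matrix.det_one]
    rw [h, map_zero] at h1
    exact zero_ne_one h1
  have hder : ∀ p : MvPolynomial ι k, aeval F p = 0 → ∀ i, aeval F (pderiv i p) = 0 := by
    intro p hp
    have h0 : (fun i => aeval F (pderiv i p)) = 0 := by
      apply Matrix.eq_zero_of_vecMul_eq_zero hdet
      rw [← Matrix.vecMul_vecMul]
      have : Matrix.vecMul (fun i => aeval F (pderiv i p)) (jacobian F) = 0 := by
        ext1 j
        have := (pderiv (R := k) j).map_mvPolynomial_aeval F p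
        rw [hp, map_zero] at this
        exact this.symm
      rw [this, Matrix.zero_vecMul]
    exact fun i => congrFun h0 i
  -- Induction on a strict bound `n` for the total degree of the relation `p`.
  have key : ∀ n : ℕ, ∀ p : MvPolynomial ι k, aeval F p = 0 →
      (∀ m, n ≤ m.degree → coeff m p = 0) → p = 0 := by
    intro n
    induction n with
    | zero => exact fun p _ h => MvPolynomial.ext _ _ fun m => h m (Nat.zero_le _)
    | succ n ih =>
      intro p hp h
      have hc := eq_C_of_pderiv_eq_zero (p := p) fun i => ih _ (hder p hp i) fun m hm => by
        rw [coeff_pderiv, h, zero_mul]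
        simpa using hm
      rw [hc, aeval_C, map_eq_zero_iff _ (FaithfulSMul.algebraMap_injective k _)] at hp
      rw [hc, hp, map_zero]
  rw [algebraicIndependent_iff]
  intro p hp
  refine key (p.totalDegree + 1) p hp fun m hm => ?_
  exact coeff_eq_zero_of_totalDegree_lt (by simpa [Finsupp.degree_apply] using hm)

/-- Algebraically independent polynomials over a field of characteristic zero have a
Jacobian matrix of full rank at some point. Complete them to a transcendence basis `s` of the
polynomial ring; its Jacobian matrix is square, and a vector in its kernel is a derivation
killing `s`, hence killing everything. -/
theorem MvPolynomial.exists_jacobian_of_algebraicIndependent {k ι κ : Type*} [Field k]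
    [CharZero k] [Fintype ι] [DecidableEq ι] [Fintype κ]
    (F : ι → MvPolynomial κ k) (hF : AlgebraicIndependent k F) :
    ∃ (a : κ → k) (N : Matrix κ ι k), (jacobian F).map (eval a) * N = 1 := by
  classical
  obtain ⟨t, hst, ht⟩ := exists_isTranscendenceBasis_superset hF.coe_range
  have hcard := ht.lift_cardinalMk_eq (IsTranscendenceBasis.mvPolynomial κ k)
  obtain ⟨e⟩ := Cardinal.lift_mk_eq'.mp hcard
  have : Fintype t := Fintype.ofEquiv κ e.symm
  let G : κ → MvPolynomial κ k := fun j => (e.symm j : MvPolynomial κ k)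
  have hrange : Set.range ((↑) : t → MvPolynomial κ k) = t := Subtype.range_coe
  have hdet : (jacobian G).det ≠ 0 := by
    intro h0
    obtain ⟨v, hv0, hv⟩ := Matrix.exists_mulVec_eq_zero_iff.mpr h0
    let D : Derivation k (MvPolynomial κ k) (MvPolynomial κ k) := mkDerivation k v
    have hD : ∀ p, D p = ∑ j, pderiv j p * v j := by
      intro p
      have := D.map_mvPolynomial_aeval X p
      simpa [D, aeval_X_left] using this
    have hDt : ∀ s ∈ Algebra.adjoin k t, D s = 0 := by
      intro s hs
      induction hs using Algebra.adjoin_induction with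
      | mem x hx =>
        have := congrFun hv (e ⟨x, hx⟩)
        rw [hD]
        simpa [Matrix.mulVec, dotProduct, jacobian, G] using this
      | algebraMap r => exact D.map_algebraMap r
      | add x y _ _ hx hy => rw [map_add, hx, hy, add_zero]
      | mul x y _ _ hx hy => rw [D.leibniz, hx, hy, smul_zero, smul_zero, add_zero]
    have halg := ht.isAlgebraic
    rw [hrange] at halg
    apply hv0
    ext1 j
    have := D.eq_zero_of_isAlgebraic _ hDt (halg.isAlgebraic (X j))
    simpa [D] using this
  obtain ⟨a, ha⟩ : ∃ a, eval a (jacobian G).det ≠ 0 := by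
    by_contra! h
    exact hdet (MvPolynomial.funext fun a => by rw [h a, map_zero])
  let M := (jacobian G).map (eval a)
  have hM : IsUnit M.det := by
    rw [isUnit_iff_ne_zero]
    rwa [RingHom.map_det] at ha
  let f : ι → κ := fun i => e ⟨F i, hst ⟨i, rfl⟩⟩
  have hf : Function.Injective f := fun i j hij => by
    have := e.injective hij
    exact hF.injective (congrArg Subtype.val this)
  refine ⟨a, (M⁻¹).submatrix id f, ?_⟩
  have h1 : (jacobian F).map (eval a) = M.submatrix f id := by
    ext i j
    simp [M, jacobian, G, f]
  rw [h1, ← Matrix.submatrix_mul M M⁻¹ f id f Function.bijective_id, Matrix.mul_nonsing_inv _ hM]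
  exact Matrix.submatrix_one f hf

end Jacobian

/-! ### Dominance of polynomial and bilinear maps -/

section Dominance

open MvPolynomial

/-- A map is dominant if and only if no nonzero polynomial function vanishes on its image. -/
theorem isDominantMap_iff {k X V : Type*} [Field k] [AddCommGroup V] [Module k V] (f : X → V) :
    IsDominantMap k f ↔ ∀ p ∈ vectorPolyFunctions k V, (∀ x, p (f x) = 0) → p = 0 := by
  let _ : TopologicalSpace V := zariskiTopology k V
  have hclosed : ∀ Z : Set V, IsClosed Z ↔ ∃ S : Set (V → k),
      S ⊆ (vectorPolyFunctions k V : Set (V → k)) ∧ Z = commonZeros S :=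
    fun Z => by
      rw [← isOpen_compl_iff]
      change Zᶜᶜ ∈ _ ↔ _
      rw [compl_compl]
      rfl
  change Dense (Set.range f) ↔ _
  constructor
  · intro hd p hp hpf
    have hcl : IsClosed (commonZeros {p}) :=
      (hclosed _).mpr ⟨{p}, Set.singleton_subset_iff.mpr hp, rfl⟩
    have hsub : Set.range f ⊆ commonZeros {p} := by
      rintro _ ⟨x, rfl⟩ q rfl
      exact hpf x
    ext v
    exact hcl.closure_subset_iff.mpr hsub (hd v) p rfl
  · intro h v
    obtain ⟨S, hS, hcl⟩ := (hclosed _).mp (isClosed_closure (s := Set.range f))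
    rw [hcl]
    intro p hp
    rw [h p (hS hp) fun x => ?_, Pi.zero_apply]
    have : f x ∈ closure (Set.range f) := subset_closure ⟨x, rfl⟩
    rw [hcl] at this
    exact this p hp

/-- In the coordinates of a basis, polynomial functions are the evaluations of polynomials. -/
theorem mem_vectorPolyFunctions_iff {k V ι : Type*} [Field k] [AddCommGroup V] [Module k V]
    [Finite ι] (c : Module.Basis ι k V) (p : V → k) :
    p ∈ vectorPolyFunctions k V ↔ ∃ P : MvPolynomial ι k, ∀ v, p v = eval (c.repr v) P := by
  have := Fintype.ofFinite ι
  constructor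
  · intro hp
    induction hp using Algebra.adjoin_induction with
    | mem q hq =>
      obtain ⟨l, rfl⟩ := hq
      refine ⟨∑ i, C (l (c i)) * X i, fun v => ?_⟩
      conv_lhs => rw [← c.sum_repr v]
      simp only [map_sum, map_smul, smul_eq_mul, map_mul, eval_C, eval_X, mul_comm]
    | algebraMap r => exact ⟨C r, fun v => by simp⟩
    | add q r _ _ hq hr =>
      obtain ⟨Q, hQ⟩ := hq
      obtain ⟨R, hR⟩ := hr
      exact ⟨Q + R, fun v => by simp [hQ, hR]⟩
    | mul q r _ _ hq hr =>
      obtain ⟨Q, hQ⟩ := hq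
      obtain ⟨R, hR⟩ := hr
      exact ⟨Q * R, fun v => by simp [hQ, hR]⟩
  · rintro ⟨P, hP⟩
    have : p = aeval (fun i v => c.coord i v) P := by
      ext v
      rw [hP]
      have := map_aeval (fun i v => c.coord i v) (Pi.evalRingHom (fun _ : V => k) v) P
      simp only [Pi.evalRingHom_apply] at this
      rw [this, eval, eval₂Hom_congr]
      · rfl
      · rfl
      · rfl
    rw [this]
    have hsub : Set.range (fun i v => c.coord i v) ⊆
        Set.range fun (l : Module.Dual k V) (v : V) => l v :=
      Set.range_subset_iff.mpr fun i => ⟨c.coord i, rfl⟩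
    refine Algebra.adjoin_mono hsub ?_
    rw [Algebra.adjoin_range_eq_range_aeval]
    exact ⟨P, rfl⟩

/-- A map given in coordinates by polynomials is dominant if and only if these polynomials are
algebraically independent. -/
theorem isDominantMap_iff_algebraicIndependent {k X V ι κ : Type*} [Field k] [Infinite k]
    [AddCommGroup V] [Module k V] [Finite ι] [Finite κ] (c : Module.Basis ι k V) (f : X → V)
    (F : ι → MvPolynomial κ k) (e : X → κ → k) (he : Function.Surjective e)
    (h : ∀ x i, c.repr (f x) i = eval (e x) (F i)) :
    IsDominantMap k f ↔ AlgebraicIndependent k F := by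
  have key : ∀ P : MvPolynomial ι k, ∀ x, eval (e x) (aeval F P) = eval (c.repr (f x)) P := by
    intro P x
    rw [map_aeval, eval]
    exact eval₂Hom_congr (by ext; simp) (funext fun i => (h x i).symm) rfl
  rw [isDominantMap_iff, algebraicIndependent_iff]
  constructor
  · intro hd P hP
    have h0 := hd (fun v => eval (c.repr v) P) ((mem_vectorPolyFunctions_iff c _).mpr
      ⟨P, fun _ => rfl⟩) fun x => by rw [← key, hP, map_zero]
    refine MvPolynomial.funext fun a => ?_
    have := congrFun h0 (c.equivFun.symm a)
    rw [map_zero]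
    simpa [← c.equivFun_apply] using this
  · intro hF p hp hpf
    obtain ⟨P, hP⟩ := (mem_vectorPolyFunctions_iff c p).mp hp
    have h0 : P = 0 := hF P <| MvPolynomial.funext fun a => by
      obtain ⟨x, rfl⟩ := he a
      rw [key, ← hP, hpf, map_zero]
    ext v
    rw [hP, h0, map_zero, Pi.zero_apply]

/-- A bilinear map is dominant if and only if its differential
`(u, v) ↦ β u y + β x v` is surjective at some point `(x, y)`. -/
theorem isDominantMap_bilinear_iff {k V₁ V₂ W : Type*} [Field k] [CharZero k]
    [AddCommGroup V₁] [Module k V₁] [FiniteDimensional k V₁]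
    [AddCommGroup V₂] [Module k V₂] [FiniteDimensional k V₂]
    [AddCommGroup W] [Module k W] [FiniteDimensional k W] (β : V₁ →ₗ[k] V₂ →ₗ[k] W) :
    IsDominantMap k (fun p : V₁ × V₂ => β p.1 p.2) ↔
      ∃ x y, ∀ w, ∃ u v, β u y + β x v = w := by
  classical
  let b₁ := Module.finBasis k V₁
  let b₂ := Module.finBasis k V₂
  let c := Module.finBasis k W
  let e : V₁ × V₂ → (Fin (Module.finrank k V₁) ⊕ Fin (Module.finrank k V₂) → k) :=
    fun p => Sum.elim (b₁.repr p.1) (b₂.repr p.2)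
  have he : Function.Surjective e := by
    intro a
    refine ⟨(b₁.equivFun.symm (a ∘ Sum.inl), b₂.equivFun.symm (a ∘ Sum.inr)), ?_⟩
    simp only [e, ← Module.Basis.equivFun_apply, LinearEquiv.apply_symm_apply]
    exact Sum.elim_comp_inl_inr a
  let F : Fin (Module.finrank k W) →
      MvPolynomial (Fin (Module.finrank k V₁) ⊕ Fin (Module.finrank k V₂)) k :=
    fun i => ∑ s, ∑ t, C (c.repr (β (b₁ s) (b₂ t)) i) * (X (Sum.inl s) * X (Sum.inr t))
  have hβ : ∀ x y i, c.repr (β x y) i =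
      ∑ s, ∑ t, c.repr (β (b₁ s) (b₂ t)) i * (b₁.repr x s * b₂.repr y t) := by
    intro x y i
    conv_lhs => rw [← b₁.sum_repr x, ← b₂.sum_repr y]
    simp only [map_sum, map_smul, LinearMap.sum_apply, LinearMap.smul_apply,
      Finsupp.coe_finsetSum, Finset.sum_apply, Finsupp.smul_apply, smul_eq_mul]
    rw [Finset.sum_comm (s := Finset.univ (α := Fin (Module.finrank k V₁)))]
    refine Finset.sum_congr rfl fun t _ => ?_
    rw [Finset.mul_sum]
    exact Finset.sum_congr rfl fun s _ => by ring
  have hF : ∀ p i, c.repr (β p.1 p.2) i = eval (e p) (F i) := by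
    intro p i
    rw [hβ]
    simp [F, e]
  -- The Jacobian matrix at `p` represents the differential at `p`.
  have hJ : ∀ p q : V₁ × V₂, ((jacobian F).map (eval (e p))).mulVec (e q) =
      c.repr (β q.1 p.2 + β p.1 q.2) := by
    intro p q
    ext i
    rw [map_add, Finsupp.add_apply, hβ, hβ]
    simp only [Matrix.mulVec, dotProduct, Fintype.sum_sum_type]
    congr 1
    · refine Finset.sum_congr rfl fun s _ => ?_
      have : eval (e p) (pderiv (Sum.inl s) (F i)) =
          ∑ t, c.repr (β (b₁ s) (b₂ t)) i * b₂.repr p.2 t := by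
        simp only [F, map_sum, Derivation.leibniz, pderiv_X]
        rw [Finset.sum_eq_single s]
        · simp [e]
        · intro s' _ hs
          simp [hs.symm]
        · simp
      simp only [jacobian, Matrix.map_apply, Matrix.of_apply, this, e, Sum.elim_inl,
        Finset.sum_mul]
      exact Finset.sum_congr rfl fun t _ => by ring
    · rw [Finset.sum_comm]
      refine Finset.sum_congr rfl fun t _ => ?_
      have : eval (e p) (pderiv (Sum.inr t) (F i)) =
          ∑ s, c.repr (β (b₁ s) (b₂ t)) i * b₁.repr p.1 s := by
        simp only [F, map_sum, Derivation.leibniz, pderiv_X]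
        refine Finset.sum_congr rfl fun s _ => ?_
        rw [Finset.sum_eq_single t]
        · simp [e]
        · intro t' _ ht
          simp [ht.symm]
        · simp
      simp only [jacobian, Matrix.map_apply, Matrix.of_apply, this, e, Sum.elim_inr,
        Finset.sum_mul]
      exact Finset.sum_congr rfl fun s _ => by ring
  have hsurj : ∀ p : V₁ × V₂, (∃ N : Matrix (Fin (Module.finrank k V₁) ⊕
      Fin (Module.finrank k V₂)) (Fin (Module.finrank k W)) k,
      (jacobian F).map (eval (e p)) * N = 1) ↔
      ∀ w, ∃ u v, β u p.2 + β p.1 v = w := by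
    intro p
    rw [← Matrix.mulVec_surjective_iff_exists_right_inverse]
    constructor
    · intro h w
      obtain ⟨a, ha⟩ := h (c.repr w)
      obtain ⟨q, rfl⟩ := he a
      refine ⟨q.1, q.2, c.repr.injective (DFunLike.coe_injective ?_)⟩
      rw [← ha, hJ]
    · intro h a
      obtain ⟨u, v, huv⟩ := h (c.equivFun.symm a)
      refine ⟨e (u, v), ?_⟩
      rw [hJ, huv, ← c.equivFun_apply, LinearEquiv.apply_symm_apply]
  rw [isDominantMap_iff_algebraicIndependent c _ F e he hF]
  constructor
  · intro h
    obtain ⟨a, hN⟩ := exists_jacobian_of_algebraicIndependent F h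
    obtain ⟨p, rfl⟩ := he a
    exact ⟨p.1, p.2, (hsurj p).mp hN⟩
  · rintro ⟨x, y, h⟩
    obtain ⟨N, hN⟩ := (hsurj (x, y)).mpr h
    exact algebraicIndependent_of_jacobian F _ N hN

end Dominance

/-! ### Reductive Lie algebras: the Killing form and the Casimir operator -/

section Reductive

open LieAlgebra

variable {k g : Type*} [Field k] [LieRing g] [LieAlgebra k g]

/-- The quotient of a Lie algebra with central radical by its centre has trivial radical. -/
theorem LieAlgebra.hasTrivialRadical_quotient_center [FiniteDimensional k g]
    [HasCentralRadical k g] : HasTrivialRadical k (g ⧸ center k g) := by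
  refine hasTrivialRadical_of_no_solvable_ideals fun I hI => ?_
  obtain ⟨n, hn⟩ := hI.solvable k I
  rw [LieIdeal.derivedSeries_eq_bot_iff] at hn
  let π : g →ₗ[k] g ⧸ center k g := (LieSubmodule.Quotient.mk' (center k g) : g →ₗ[k] _)
  have hπ : ∀ x y : g, π ⁅x, y⁆ = ⁅π x, π y⁆ := fun _ _ => rfl
  -- The preimage of `I`: it is solvable, being an extension of `I` by the centre.
  let J : LieIdeal k g :=
    { I.toSubmodule.comap π with
      lie_mem := fun {x m} hm => by
        change π ⁅x, m⁆ ∈ I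
        rw [hπ]
        exact I.lie_mem hm }
  have hJ : ∀ m, ∀ x ∈ derivedSeriesOfIdeal k g m J, π x ∈ derivedSeriesOfIdeal k _ m I := by
    intro m
    induction m with
    | zero => exact fun x hx => hx
    | succ m ih =>
      intro x hx
      rw [derivedSeriesOfIdeal_succ, ← LieSubmodule.mem_toSubmodule,
        LieSubmodule.lieIdeal_oper_eq_linear_span'] at hx
      induction hx using Submodule.span_induction with
      | mem x hx =>
        obtain ⟨a, ha, b, hb, rfl⟩ := hx
        rw [hπ, derivedSeriesOfIdeal_succ]
        exact LieSubmodule.lie_mem_lie (ih a ha) (ih b hb)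
      | zero => rw [map_zero]; exact zero_mem _
      | add x y _ _ hx hy => rw [map_add]; exact add_mem hx hy
      | smul c x _ hx => rw [map_smul]; exact Submodule.smul_mem _ c hx
  have hker : derivedSeriesOfIdeal k g n J ≤ center k g := by
    intro x hx
    have := hJ n x hx
    rw [hn, LieSubmodule.mem_bot] at this
    exact LieSubmodule.Quotient.mk_eq_zero'.mp this
  have hJsolv : IsSolvable J := by
    refine IsSolvable.mk (R := k) (k := n + 1) ?_
    rw [LieIdeal.derivedSeries_eq_bot_iff, derivedSeriesOfIdeal_succ, eq_bot_iff,
      LieSubmodule.lieIdeal_oper_eq_span, LieSubmodule.lieSpan_le]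
    rintro _ ⟨⟨a, ha⟩, ⟨b, hb⟩, rfl⟩
    exact (LieModule.mem_maxTrivSubmodule k g g b).mp (hker hb) a
  have hJle : J ≤ center k g := by
    rw [← HasCentralRadical.radical_eq_center, ← LieIdeal.solvable_iff_le_radical]
    exact hJsolv
  rw [eq_bot_iff]
  intro y hy
  obtain ⟨x, rfl⟩ := LieSubmodule.Quotient.surjective_mk' (center k g) y
  exact LieSubmodule.Quotient.mk_eq_zero'.mpr (hJle (show x ∈ J from hy))

/-- The Casimir operator of `g / z(g)` acting on a reductive Lie algebra `g`: it vanishes on the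
centre, commutes with the adjoint action, and is the identity modulo the centre. -/
theorem LieAlgebra.exists_casimir [CharZero k] [FiniteDimensional k g] [HasCentralRadical k g] :
    ∃ C : g →ₗ[k] g, (∀ z ∈ center k g, C z = 0) ∧ (∀ x z : g, C ⁅x, z⁆ = ⁅x, C z⁆) ∧
      ∀ x : g, C x - x ∈ center k g := by
  classical
  have := hasTrivialRadical_quotient_center (k := k) (g := g)
  let s := g ⧸ center k g
  let π : g →ₗ[k] s := (LieSubmodule.Quotient.mk' (center k g) : g →ₗ[k] s)
  have hπ : ∀ x y : g, π ⁅x, y⁆ = ⁅π x, π y⁆ := fun _ _ => rfl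
  have hπs : Function.Surjective π := LieSubmodule.Quotient.surjective_mk' _
  have hπ0 : ∀ x, π x = 0 ↔ x ∈ center k g := fun x => LieSubmodule.Quotient.mk_eq_zero'
  let κ : LinearMap.BilinForm k s := killingForm k s
  have hκ : κ.Nondegenerate := IsKilling.killingForm_nondegenerate k s
  have hsymm : ∀ x y, κ x y = κ y x := LieModule.traceForm_comm k s s
  have hinv : ∀ x y z, κ ⁅x, y⁆ z = κ x ⁅y, z⁆ := LieModule.traceForm_apply_lie_apply k s s
  have : FiniteDimensional k s := Module.Finite.of_surjective π hπs
  let b := Module.finBasis k s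
  let d := κ.dualBasis hκ b
  have hbr : ∀ x i, b.repr x i = κ x (d i) := by
    intro x i
    rw [← LinearMap.BilinForm.dualBasis_repr_apply hκ d,
      LinearMap.BilinForm.dualBasis_dualBasis hκ ⟨hsymm⟩ b]
  have hb : ∀ x, x = ∑ i, κ x (d i) • b i := by
    intro x
    conv_lhs => rw [← b.sum_repr x]
    simp only [hbr]
  have hd : ∀ x, x = ∑ i, κ x (b i) • d i := by
    intro x
    conv_lhs => rw [← d.sum_repr x]
    simp [d]
  -- The adjoint action of `g` factors through the quotient `s` by the centre.
  let T : s →ₗ[k] Module.End k g := (center k g).toSubmodule.liftQ (ad k g : g →ₗ[k] _) (by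
    intro z hz
    ext x
    have := (LieModule.mem_maxTrivSubmodule k g g z).mp hz x
    change ⁅z, x⁆ = 0
    rw [← lie_skew, this, neg_zero])
  have hT : ∀ x y, T (π x) y = ⁅x, y⁆ := fun _ _ => rfl
  have hTlie : ∀ x t y, ⁅x, T t y⁆ = T ⁅π x, t⁆ y + T t ⁅x, y⁆ := by
    intro x t y
    obtain ⟨t, rfl⟩ := hπs t
    rw [← hπ, hT, hT, hT, leibniz_lie]
  have hTπ : ∀ t y, π (T t y) = ⁅t, π y⁆ := by
    intro t y
    obtain ⟨t, rfl⟩ := hπs t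
    rw [hT, hπ]
  refine ⟨∑ i, T (d i) ∘ₗ T (b i), ?_, ?_, ?_⟩
  · intro z hz
    have : ∀ t, T t z = 0 := by
      intro t
      obtain ⟨t, rfl⟩ := hπs t
      exact (LieModule.mem_maxTrivSubmodule k g g z).mp hz t
    simp [this]
  · intro x z
    simp only [LinearMap.sum_apply, LinearMap.comp_apply, lie_sum, hTlie, Finset.sum_add_distrib,
      map_add]
    rw [← add_assoc, right_eq_add]
    have h1 : ∀ i, T ⁅π x, d i⁆ (T (b i) z) =
        ∑ j, κ ⁅π x, d i⁆ (b j) • T (d j) (T (b i) z) := by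
      intro i
      conv_lhs => rw [hd ⁅π x, d i⁆]
      simp
    have h2 : ∀ i, T (d i) (T ⁅π x, b i⁆ z) =
        ∑ j, κ ⁅π x, b i⁆ (d j) • T (d i) (T (b j) z) := by
      intro i
      conv_lhs => rw [hb ⁅π x, b i⁆]
      simp
    simp only [h1, h2]
    rw [Finset.sum_comm (f := fun i j => κ ⁅π x, b i⁆ (d j) • T (d i) (T (b j) z)),
      ← Finset.sum_add_distrib]
    refine Finset.sum_eq_zero fun i _ => ?_
    rw [← Finset.sum_add_distrib]
    refine Finset.sum_eq_zero fun j _ => ?_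
    rw [← add_smul]
    have : κ ⁅π x, d i⁆ (b j) + κ ⁅π x, b j⁆ (d i) = 0 := by
      rw [← lie_skew (π x) (d i), map_neg, LinearMap.neg_apply, hinv, hsymm (d i)]
      exact neg_add_cancel _
    rw [this, zero_smul]
  · intro x
    rw [← hπ0, map_sub, sub_eq_zero]
    simp only [LinearMap.sum_apply, LinearMap.comp_apply, map_sum, hTπ]
    refine LinearMap.ker_eq_bot.mp hκ.ker_eq_bot (LinearMap.ext fun w => ?_)
    -- Both sides pair with `w` to the trace of `ad w ∘ ad (π x)`.
    have htr : ∀ f : Module.End k s, LinearMap.trace k s f = ∑ i, κ (f (b i)) (d i) := by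
      intro f
      rw [LinearMap.trace_eq_matrix_trace k b, Matrix.trace]
      refine Finset.sum_congr rfl fun i _ => ?_
      rw [Matrix.diag_apply, LinearMap.toMatrix_apply, hbr]
    rw [hsymm (π x) w, show κ w (π x) = _ from killingForm_apply_apply k s w (π x), htr, map_sum,
      LinearMap.sum_apply]
    refine Finset.sum_congr rfl fun i _ => ?_
    rw [hinv, hsymm, LinearMap.comp_apply, ad_apply, ad_apply, ← lie_skew w, ← lie_skew (π x),
      neg_lie, neg_neg]

end Reductive

/-! ### Duality for the Killing form on the graded pieces -/

section Grading

open LieAlgebra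

variable {k g : Type*} [Field k] [LieRing g] [LieAlgebra k g]

theorem LieAlgebra.mem_center_of_killingForm_eq_zero [CharZero k] [FiniteDimensional k g]
    [HasCentralRadical k g] {x : g} (hx : ∀ y, killingForm k g x y = 0) : x ∈ center k g := by
  rw [← HasCentralRadical.radical_eq_center]
  apply killingCompl_top_le_radical k g
  rw [LieIdeal.mem_killingCompl]
  intro y _
  rw [LieModule.traceForm_comm, hx]

theorem LieAlgebra.killingForm_eq_zero_of_mem_center {z : g} (hz : z ∈ center k g) (x : g) :
    killingForm k g z x = 0 := by
  have : ad k g z = 0 := by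
    ext y
    rw [ad_apply, ← lie_skew, (LieModule.mem_maxTrivSubmodule k g g z).mp hz y, neg_zero,
      LinearMap.zero_apply]
  rw [killingForm_apply_apply, this, LinearMap.zero_comp, map_zero]

/-- On each graded piece the radical of the Killing form consists of central elements, since
distinct pieces are orthogonal. -/
theorem mem_center_of_orthogonal_gradedPart [CharZero k] [FiniteDimensional k g]
    [HasCentralRadical k g] {σ₁ σ₂ : g ≃ₗ⁅k⁆ g} (hσ₁ : Function.Involutive σ₁)
    (hσ₂ : Function.Involutive σ₂) (hcomm : Function.Commute σ₁ σ₂) {i j : Fin 2} {x : g}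
    (hx : x ∈ gradedPart σ₁ σ₂ i j)
    (h : ∀ y ∈ gradedPart σ₁ σ₂ i j, killingForm k g x y = 0) : x ∈ center k g := by
  refine mem_center_of_killingForm_eq_zero fun y => ?_
  obtain ⟨a, ha⟩ : ∃ a : k, a = (-1) ^ (i : ℕ) := ⟨_, rfl⟩
  obtain ⟨b, hb⟩ : ∃ b : k, b = (-1) ^ (j : ℕ) := ⟨_, rfl⟩
  have ha2 : a * a = 1 := by rw [ha, ← pow_add, Even.neg_one_pow ⟨_, rfl⟩]
  have hb2 : b * b = 1 := by rw [hb, ← pow_add, Even.neg_one_pow ⟨_, rfl⟩]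
  obtain ⟨hx₁, hx₂⟩ := hx
  rw [← ha] at hx₁
  rw [← hb] at hx₂
  have h₁ : ∀ y, killingForm k g x (σ₁ y) = a * killingForm k g x y := by
    intro y
    rw [← killingForm_of_equiv_apply σ₁ x y, hx₁, map_smul, LinearMap.smul_apply, smul_eq_mul,
      ← mul_assoc, ha2, one_mul]
  have h₂ : ∀ y, killingForm k g x (σ₂ y) = b * killingForm k g x y := by
    intro y
    rw [← killingForm_of_equiv_apply σ₂ x y, hx₂, map_smul, LinearMap.smul_apply, smul_eq_mul,
      ← mul_assoc, hb2, one_mul]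
  -- `4⁻¹ • q` is the projection of `y` to the `(i, j)` piece.
  let q := y + a • σ₁ y + b • σ₂ y + (a * b) • σ₁ (σ₂ y)
  have hq : q ∈ gradedPart σ₁ σ₂ i j := by
    have hc : ∀ w, σ₂ (σ₁ w) = σ₁ (σ₂ w) := fun w => (hcomm w).symm
    constructor
    · rw [← ha]
      simp only [q, map_add, map_smul, hσ₁ y, hσ₁ (σ₂ y), smul_add, smul_smul, ← mul_assoc, ha2,
        one_mul, one_smul]
      abel
    · rw [← hb]
      simp only [q, map_add, map_smul, hc, hσ₂ y, smul_add, smul_smul, mul_left_comm b a b, hb2,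
        mul_one, one_smul, mul_comm b a]
      abel
  have h4 := h q hq
  simp only [q, map_add, map_smul, h₁, h₂, smul_eq_mul] at h4
  have : (4 : k) * killingForm k g x y = 0 := by
    linear_combination h4 - (1 + b * b) * killingForm k g x y * ha2 -
      2 * killingForm k g x y * hb2
  exact (mul_eq_zero.mp this).resolve_left (OfNat.ofNat_ne_zero 4)

/-- The differential of the commutator map at `(x, y)` is surjective if and only if the
centralisers of `x` and `y` meet trivially in `g₀₁`: the orthogonal complement of its image is,
up to the centre, the intersection of these centralisers. -/
theorem surjective_differential_iff [CharZero k] [FiniteDimensional k g] [HasCentralRadical k g]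
    {σ₁ σ₂ : g ≃ₗ⁅k⁆ g} (hσ₁ : Function.Involutive σ₁) (hσ₂ : Function.Involutive σ₂)
    (hcomm : Function.Commute σ₁ σ₂) {x y : g} (hx : x ∈ gradedPart σ₁ σ₂ 1 0)
    (hy : y ∈ gradedPart σ₁ σ₂ 1 1) :
    (∀ w ∈ gradedPart σ₁ σ₂ 0 1, ∃ u ∈ gradedPart σ₁ σ₂ 1 0, ∃ v ∈ gradedPart σ₁ σ₂ 1 1,
      ⁅u, y⁆ + ⁅x, v⁆ = w) ↔
    (elementCentralizer k x ⊓ gradedPart σ₁ σ₂ 0 1) ⊓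
          (elementCentralizer k y ⊓ gradedPart σ₁ σ₂ 0 1) = ⊥ := by
  obtain ⟨C, hC0, hClie, hCcenter⟩ := exists_casimir (k := k) (g := g)
  -- On brackets the Casimir operator is the identity, so central elements and brackets meet in `0`.
  have hCfix : ∀ a b : g, C ⁅a, b⁆ = ⁅a, b⁆ := by
    intro a b
    have := (LieModule.mem_maxTrivSubmodule k g g _).mp (hCcenter b) a
    rw [hClie]
    rwa [lie_sub, sub_eq_zero] at this
  have hinv : ∀ a b c : g, killingForm k g ⁅a, b⁆ c = -killingForm k g b ⁅a, c⁆ :=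
    LieModule.traceForm_apply_lie_apply' k g g
  have hsymm : ∀ a b : g, killingForm k g a b = killingForm k g b a :=
    LieModule.traceForm_comm k g g
  constructor
  · intro h
    rw [eq_bot_iff]
    rintro z ⟨⟨hxz, hz⟩, ⟨hyz, -⟩⟩
    change ⁅x, z⁆ = 0 at hxz
    change ⁅y, z⁆ = 0 at hyz
    have hcent : z ∈ center k g := by
      refine mem_center_of_orthogonal_gradedPart hσ₁ hσ₂ hcomm hz fun w hw => ?_
      obtain ⟨u, -, v, -, rfl⟩ := h w hw
      rw [hsymm, map_add, LinearMap.add_apply, ← lie_skew u y, map_neg, LinearMap.neg_apply, hinv,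
        hinv, hxz, hyz]
      simp
    obtain ⟨u, -, v, -, huv⟩ := h z hz
    have h1 := hC0 z hcent
    rw [← huv, map_add, hCfix, hCfix, huv] at h1
    exact h1
  · intro h
    let S : Submodule k g :=
      (gradedPart σ₁ σ₂ 1 0).map (ad k g y : g →ₗ[k] g) ⊔
        (gradedPart σ₁ σ₂ 1 1).map (ad k g x : g →ₗ[k] g)
    -- An element of `g₀₁` orthogonal to `S` commutes with `x` and `y`.
    have hS : ∀ z ∈ gradedPart σ₁ σ₂ 0 1, (∀ s ∈ S, killingForm k g z s = 0) → z = 0 := by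
      intro z hz hzS
      obtain ⟨hz₁, hz₂⟩ := hz
      have hxz : ⁅x, z⁆ ∈ center k g := by
        have hmem : ⁅x, z⁆ ∈ gradedPart σ₁ σ₂ 1 1 := by
          constructor
          · rw [LieEquiv.map_lie, hx.1, hz₁]; simp
          · rw [LieEquiv.map_lie, hx.2, hz₂]; simp
        refine mem_center_of_orthogonal_gradedPart hσ₁ hσ₂ hcomm hmem fun v hv => ?_
        rw [hinv, neg_eq_zero]
        exact hzS _ (Submodule.mem_sup_right ⟨v, hv, rfl⟩)
      have hyz : ⁅y, z⁆ ∈ center k g := by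
        have hmem : ⁅y, z⁆ ∈ gradedPart σ₁ σ₂ 1 0 := by
          constructor
          · rw [LieEquiv.map_lie, hy.1, hz₁]; simp
          · rw [LieEquiv.map_lie, hy.2, hz₂]; simp
        refine mem_center_of_orthogonal_gradedPart hσ₁ hσ₂ hcomm hmem fun u hu => ?_
        rw [hinv, neg_eq_zero]
        exact hzS _ (Submodule.mem_sup_left ⟨u, hu, rfl⟩)
      have hbot : z ∈ (⊥ : Submodule k g) := by
        rw [← h]
        exact ⟨⟨(hCfix x z).symm.trans (hC0 _ hxz), hz₁, hz₂⟩,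
          ⟨(hCfix y z).symm.trans (hC0 _ hyz), hz₁, hz₂⟩⟩
      exact hbot
    have hSle : S ≤ gradedPart σ₁ σ₂ 0 1 := by
      refine sup_le ?_ ?_
      · rintro _ ⟨u, hu, rfl⟩
        change ⁅y, u⁆ ∈ _
        rw [← lie_skew y u]
        exact neg_mem (lie_mem_gradedPart σ₁ σ₂ hu hy)
      · rintro _ ⟨v, hv, rfl⟩
        exact lie_mem_gradedPart σ₁ σ₂ hx hv
    have hle : gradedPart σ₁ σ₂ 0 1 ≤ S := by
      -- The Killing form embeds `g₀₁` into the dual of `S`, so `dim g₀₁ ≤ dim S`.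
      let Φ : gradedPart σ₁ σ₂ 0 1 →ₗ[k] Module.Dual k S :=
        (killingForm k g).domRestrict₁₂ (gradedPart σ₁ σ₂ 0 1) S
      have hΦ : Function.Injective Φ := by
        rw [← LinearMap.ker_eq_bot, eq_bot_iff]
        intro z hz
        exact Subtype.ext (hS z z.2 fun s hs => LinearMap.congr_fun hz ⟨s, hs⟩)
      have hdim := LinearMap.finrank_le_finrank_of_injective hΦ
      rw [Subspace.dual_finrank_eq] at hdim
      exact (Submodule.eq_of_le_of_finrank_le hSle hdim).ge
    intro w hw
    obtain ⟨_, ⟨u, hu, rfl⟩, _, ⟨v, hv, rfl⟩, huv⟩ := Submodule.mem_sup.mp (hle hw)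
    refine ⟨-u, neg_mem hu, v, hv, ?_⟩
    rw [neg_lie, lie_skew]
    exact huv

end Grading

theorem mainTheorem9 {k g : Type*} [Field k] [IsAlgClosed k] [CharZero k]
    [LieRing g] [LieAlgebra k g] [FiniteDimensional k g]
    [LieAlgebra.HasCentralRadical k g]
    (σ₁ σ₂ : g ≃ₗ⁅k⁆ g) (hσ₁ : Function.Involutive σ₁) (hσ₂ : Function.Involutive σ₂)
    (hcomm : Function.Commute σ₁ σ₂) :
    IsDominantMap k (commutatorMap σ₁ σ₂) ↔
      ∃ x ∈ gradedPart σ₁ σ₂ 1 0, ∃ y ∈ gradedPart σ₁ σ₂ 1 1,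
        (elementCentralizer k x ⊓ gradedPart σ₁ σ₂ 0 1) ⊓
          (elementCentralizer k y ⊓ gradedPart σ₁ σ₂ 0 1) = ⊥ := by
  let β : gradedPart σ₁ σ₂ 1 0 →ₗ[k] gradedPart σ₁ σ₂ 1 1 →ₗ[k] gradedPart σ₁ σ₂ 0 1 :=
    LinearMap.mk₂ k (fun x y => commutatorMap σ₁ σ₂ (x, y))
      (fun x x' y => Subtype.ext (add_lie (x : g) x' (y : g)))
      (fun c x y => Subtype.ext (smul_lie c (x : g) (y : g)))
      (fun x y y' => Subtype.ext (lie_add (x : g) (y : g) y'))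
      (fun c x y => Subtype.ext (lie_smul c (x : g) (y : g)))
  refine (isDominantMap_bilinear_iff β).trans ?_
  constructor
  · rintro ⟨x, y, h⟩
    refine ⟨x, x.2, y, y.2,
      (surjective_differential_iff hσ₁ hσ₂ hcomm x.2 y.2).mp fun w hw => ?_⟩
    obtain ⟨u, v, huv⟩ := h ⟨w, hw⟩
    exact ⟨u, u.2, v, v.2, congrArg Subtype.val huv⟩
  · rintro ⟨x, hx, y, hy, h⟩
    refine ⟨⟨x, hx⟩, ⟨y, hy⟩, fun w => ?_⟩
    obtain ⟨u, hu, v, hv, huv⟩ :=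
      (surjective_differential_iff hσ₁ hσ₂ hcomm hx hy).mpr h w w.2
    exact ⟨⟨u, hu⟩, ⟨v, hv⟩, Subtype.ext huv⟩
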